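/- Equip $\omega_1$, the set of all countable ordinals, with the order topology. For a space $X$ let $\mathcal{K}(X)$ be the set of all compact subsets of $X$, ordered by inclusion. A partially ordered set $P$ has calibre $(\kappa,\lambda,\mu)$ if every subset $T\subseteq P$ of size $\kappa$ has a subset $T_0\subseteq T$ of size $\lambda$ such that every subset $T_1\subseteq T_0$ of size $\mu$ has an upper bound in $P$. Let $\mathfrak{b}$ be the bounding number, i.e. the least size of a family $F$ of functions $\omega\to\omega$ for which there is no $g:\omega\to\omega$ such that every $f\in F$ satisfies $f(n)\le g(n)$ for all but finitely many $n$. Lemma. Let $S\subseteq\omega_1$ be unbounded, give $S$ the subspace topology, and let $\overline{S}$ denote the closure of $S$ in $\omega_1$. Then $\mathcal{K}(S)$ has calibre $(\omega_1,\omega_1,\omega)$ if and only if $\overline{S}\setminus S$ is bounded in $\omega_1$ and, moreover, either $\overline{S}\setminus S$ is closed in $\omega_1$ or $\omega_1<\mathfrak{b}$. -/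

import Mathlib

/-- The space `ω₁` of countable ordinals, as the set of ordinals below the first uncountable one.
It carries the induced order and the induced (equivalently: the order) topology. -/
abbrev OmegaOne : Type 1 := Set.Iio (Ordinal.omega.{0} 1)

/-- A partially ordered set `P` has calibre `(κ, l, m)`: every subset `T` of size `κ` has a subset
`T₀` of size `l` such that every subset `T₁ ⊆ T₀` of size `m` has an upper bound in `P`. -/
def HasCalibre (P : Type*) [PartialOrder P] (κ l m : Cardinal) : Prop :=
  ∀ T : Set P, Cardinal.mk T = κ →
    ∃ T₀ : Set P, T₀ ⊆ T ∧ Cardinal.mk T₀ = l ∧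
      ∀ T₁ : Set P, T₁ ⊆ T₀ → Cardinal.mk T₁ = m → BddAbove T₁

/-- The bounding number `𝔟`: the least size of a family of functions `ℕ → ℕ` which is unbounded
with respect to eventual domination. -/
noncomputable def boundingNumber : Cardinal.{0} :=
  sInf {c | ∃ F : Set (ℕ → ℕ), Cardinal.mk F = c ∧
    ¬ ∃ g : ℕ → ℕ, ∀ f ∈ F, ∀ᶠ n in Filter.atTop, f n ≤ g n}

/-! Write `D` for `closure S \ S`. Necessity: encode data in `ω₁` many compacts and use the calibre
to get an unbounded set of indices, any countably many of whose compacts lie in one closed subset of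
`S`. If these compacts pick terms of a sequence tending to a point outside `S`, the positions picked
are bounded (`exists_bound_of_tendsto`). Encoding injections into `ℕ` rules out unbounded `D`;
encoding a family witnessing `𝔟 ≤ ℵ₁` near a limit of `D` in `S` rules out non-closed `D`.

Sufficiency: by `hasCalibre_of_closed_cover`, countably many closed subsets of `S` must capture all
given compacts. They arise from `closure S` by removing basic neighbourhoods of the countable set
`D`: finitely many suffice if `D` is compact; otherwise `ℵ₁ < 𝔟` gives one function choosing them
for all compacts, up to a constant. -/

open Set Filter Topology TopologicalSpace

/-! ### Topology and cofinality of `ω₁` -/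

namespace OmegaOne

theorem mk_eq : Cardinal.mk OmegaOne = Cardinal.aleph 1 := by
  rw [Cardinal.mk_Iio_ordinal, Ordinal.card_omega, Cardinal.lift_aleph, Ordinal.lift_one]

theorem countable_Iio (a : OmegaOne) : (Iio a).Countable := by
  have h : (Iio a.1).Countable := by
    rw [← Cardinal.le_aleph0_iff_set_countable, Cardinal.mk_Iio_ordinal,
      Cardinal.lift_le_aleph0, ← Order.lt_succ_iff, Cardinal.succ_aleph0, Cardinal.lt_ord.symm,
      Cardinal.ord_aleph]
    exact a.2
  exact (h.preimage Subtype.val_injective).mono fun x hx => hx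

theorem countable_Iic (a : OmegaOne) : (Iic a).Countable := by
  rw [← Iio_insert]
  exact (countable_Iio a).insert a

theorem countable_of_bddAbove {A : Set OmegaOne} (h : BddAbove A) : A.Countable := by
  obtain ⟨b, hb⟩ := h
  exact (countable_Iic b).mono hb

instance : NoMaxOrder OmegaOne where
  exists_gt a := by
    have h : Order.succ a.1 < Ordinal.omega 1 := (Cardinal.isSuccLimit_omega 1).succ_lt a.2
    exact ⟨⟨_, h⟩, Order.lt_succ a.1⟩

theorem bddAbove_of_countable {A : Set OmegaOne} (h : A.Countable) : BddAbove A := by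
  have := h.to_subtype
  have hlt : ⨆ x : A, x.1.1 < Ordinal.omega 1 := Ordinal.iSup_lt_omega_one fun x => x.1.2
  refine ⟨⟨_, hlt⟩, fun x hx => ?_⟩
  exact le_ciSup (f := fun x : A => x.1.1)
    ⟨Ordinal.omega 1, by rintro _ ⟨y, rfl⟩; exact y.1.2.le⟩ ⟨x, hx⟩

theorem exists_mem_ge {A : Set OmegaOne} (h : ¬ BddAbove A) (a : OmegaOne) : ∃ x ∈ A, a ≤ x := by
  obtain ⟨x, hx, hax⟩ := not_bddAbove_iff.1 h a
  exact ⟨x, hx, hax.le⟩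

/-- Left neighbourhoods already generate `𝓝 a`, and there are only countably many `b < a`. -/
instance : FirstCountableTopology OmegaOne where
  nhds_generated_countable a := by
    have := (countable_Iio a).to_subtype
    rw [← SuccOrder.nhdsLE_eq_nhds, nhdsWithin, nhds_eq_order, iInf_subtype', iInf_subtype', inf_assoc]
    have h : (⨅ b : Ioi a, 𝓟 (Iio b.1)) ⊓ 𝓟 (Iic a) = 𝓟 (Iic a) := by
      refine inf_eq_right.2 (le_iInf fun b => ?_)
      exact principal_mono.2 fun x (hx : x ≤ a) => hx.trans_lt b.2
    rw [h]
    infer_instance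

theorem isCompact_of_isClosed_of_bddAbove {A : Set OmegaOne} (hc : IsClosed A) (hb : BddAbove A) :
    IsCompact A := by
  obtain ⟨b, hb⟩ := hb
  have h : IsCompact (Iic b) := by
    rw [Subtype.isCompact_iff]
    have : Subtype.val '' Iic b = Icc 0 b.1 := by
      ext x
      constructor
      · rintro ⟨y, hy, rfl⟩
        exact ⟨zero_le, hy⟩
      · rintro ⟨-, hx⟩
        exact ⟨⟨x, lt_of_le_of_lt hx b.2⟩, hx, rfl⟩
    rw [this]
    exact isCompact_Icc
  exact h.of_isClosed_subset hc hb

theorem exists_unbounded_fiber {β : Type*} [Countable β] {A : Set OmegaOne} (hA : ¬ BddAbove A)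
    (f : OmegaOne → β) : ∃ b, ¬ BddAbove {a ∈ A | f a = b} := by
  by_contra! h
  refine hA (bddAbove_of_countable ?_)
  have : A = ⋃ b, {a ∈ A | f a = b} := by ext; simp
  rw [this]
  exact countable_iUnion fun b => countable_of_bddAbove (h b)

end OmegaOne

/-- A compact subset of `S`, viewed in the ambient space. -/
def TopologicalSpace.Compacts.ambient {X : Type*} [TopologicalSpace X] {S : Set X}
    (K : Compacts S) : Set X :=
  Subtype.val '' (K : Set S)

/-! ### Compact subsets of a subspace -/

namespace TopologicalSpace.Compacts

variable {X : Type*} [TopologicalSpace X] {S : Set X}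

theorem ambient_subset (K : Compacts S) : K.ambient ⊆ S := by
  rintro _ ⟨x, -, rfl⟩
  exact x.2

theorem isCompact_ambient (K : Compacts S) : IsCompact K.ambient :=
  K.isCompact.image continuous_subtype_val

theorem ambient_mono {K L : Compacts S} (h : K ≤ L) : K.ambient ⊆ L.ambient :=
  image_mono h

/-- A compact subset of the ambient space contained in `S`, as a compact subset of `S`. -/
def ofAmbient (A : Set X) (hA : IsCompact A) (h : A ⊆ S) : Compacts S where
  carrier := Subtype.val ⁻¹' A
  isCompact' := by
    rw [Subtype.isCompact_iff, Subtype.image_preimage_coe, inter_eq_right.2 h]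
    exact hA

@[simp]
theorem ambient_ofAmbient (A : Set X) (hA : IsCompact A) (h : A ⊆ S) :
    (ofAmbient A hA h).ambient = A := by
  change Subtype.val '' (Subtype.val ⁻¹' A) = A
  rw [Subtype.image_preimage_coe, inter_eq_right.2 h]

theorem le_ofAmbient {A : Set X} {hA : IsCompact A} {h : A ⊆ S} {K : Compacts S}
    (hK : K.ambient ⊆ A) : K ≤ ofAmbient A hA h :=
  fun x hx => hK ⟨x, hx, rfl⟩

end TopologicalSpace.Compacts

/-! ### Necessity -/

theorem HasCalibre.exists_unbounded_subset {P : Type 1} [PartialOrder P]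
    (hP : HasCalibre P (Cardinal.aleph 1) (Cardinal.aleph 1) Cardinal.aleph0)
    (F : OmegaOne → P) :
    ∃ A : Set OmegaOne, ¬ BddAbove A ∧ ∀ B ⊆ A, B.Countable → BddAbove (F '' B) := by
  by_cases hF : (range F).Countable
  · have := hF.to_subtype
    have hu : ¬ BddAbove (univ : Set OmegaOne) := not_bddAbove_univ
    obtain ⟨b, hb⟩ := OmegaOne.exists_unbounded_fiber hu (rangeFactorization F)
    refine ⟨_, hb, fun B hB _ => ⟨b.1, ?_⟩⟩
    rintro _ ⟨a, ha, rfl⟩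
    exact (congrArg Subtype.val (hB ha).2).le
  · have hcard : Cardinal.mk (range F) = Cardinal.aleph 1 := by
      refine le_antisymm (Cardinal.mk_range_le.trans OmegaOne.mk_eq.le) ?_
      rw [← Cardinal.succ_aleph0, Order.succ_le_iff]
      rw [← Cardinal.le_aleph0_iff_set_countable] at hF
      exact not_le.1 hF
    obtain ⟨T, hTF, hT, hbdd⟩ := hP _ hcard
    refine ⟨F ⁻¹' T, fun h => ?_, fun B hB hBc => ?_⟩
    · have h1 := (OmegaOne.countable_of_bddAbove h).image F
      rw [image_preimage_eq_of_subset hTF, ← Cardinal.le_aleph0_iff_set_countable, hT] at h1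
      exact absurd h1 (not_le.2 Cardinal.aleph0_lt_aleph_one)
    · have hle : Cardinal.aleph0 ≤ Cardinal.mk T := by
        rw [hT]; exact Cardinal.aleph0_lt_aleph_one.le
      -- `B` may be finite or have finite image; adding `Q` makes the size exactly `ℵ₀`.
      obtain ⟨Q, hQT, hQ⟩ := Cardinal.le_mk_iff_exists_subset.1 hle
      have hsub : F '' B ∪ Q ⊆ T := union_subset (image_subset_iff.2 hB) hQT
      refine (hbdd (F '' B ∪ Q) hsub ?_).mono subset_union_left
      refine le_antisymm ?_ ?_
      · rw [Cardinal.le_aleph0_iff_set_countable]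
        exact (hBc.image F).union (Cardinal.le_aleph0_iff_set_countable.1 hQ.le)
      · rw [← hQ]
        exact Cardinal.mk_le_mk_of_subset subset_union_right

/-- For `ω₁` many compact subsets of `S`, calibre `(ℵ₁, ℵ₁, ℵ₀)` yields an unbounded set of indices
such that any countably many of the compacts lie in one closed subset of `S`. -/
theorem HasCalibre.exists_unbounded_ambient {S : Set OmegaOne}
    (hP : HasCalibre (Compacts S) (Cardinal.aleph 1) (Cardinal.aleph 1) Cardinal.aleph0)
    (F : OmegaOne → Set OmegaOne) (hF : ∀ a, IsCompact (F a)) (hFS : ∀ a, F a ⊆ S) :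
    ∃ A : Set OmegaOne, ¬ BddAbove A ∧
      ∀ B ⊆ A, B.Countable → ∃ K, IsClosed K ∧ K ⊆ S ∧ ∀ a ∈ B, F a ⊆ K := by
  obtain ⟨A, hA, h⟩ := hP.exists_unbounded_subset fun a => Compacts.ofAmbient (F a) (hF a) (hFS a)
  refine ⟨A, hA, fun B hB hBc => ?_⟩
  obtain ⟨K, hK⟩ := h B hB hBc
  refine ⟨K.ambient, K.isCompact_ambient.isClosed, K.ambient_subset, fun a ha => ?_⟩
  simpa using Compacts.ambient_mono (hK ⟨a, ha, rfl⟩)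

/-- Otherwise a countable subfamily picks arbitrarily late terms of `s`; a closed set covering it
contains the limit `d`, yet lies in `S`. -/
theorem exists_bound_of_tendsto {ι X : Type*} [TopologicalSpace X] {S : Set X} {F : ι → Set X}
    {A : Set ι}
    (hA : ∀ B ⊆ A, B.Countable → ∃ K, IsClosed K ∧ K ⊆ S ∧ ∀ a ∈ B, F a ⊆ K)
    {d : X} (hd : d ∉ S) {s : ℕ → X} (hs : Tendsto s atTop (𝓝 d)) {φ : ι → ℕ} {A' : Set ι}
    (hA' : A' ⊆ A) (hφ : ∀ a ∈ A', s (φ a) ∈ F a) : ∃ M, ∀ a ∈ A', φ a ≤ M := by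
  by_contra! h
  choose b hb hlt using h
  obtain ⟨K, hK, hKS, hFK⟩ := hA (range b) (by rintro _ ⟨n, rfl⟩; exact hA' (hb n))
    (countable_range b)
  refine hd (hKS (hK.mem_of_frequently_of_tendsto (frequently_atTop.2 fun n => ?_) hs))
  exact ⟨φ (b n), (hlt n).le, hFK _ (mem_range_self n) (hφ _ (hb n))⟩

theorem mem_closure_inter_of_mem_nhds {X : Type*} [TopologicalSpace X] {S V : Set X} {d : X}
    (hd : d ∈ closure S) (hV : V ∈ 𝓝 d) : d ∈ closure (S ∩ V) :=
  mem_closure_iff_nhds.2 fun U hU => by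
    obtain ⟨x, hx, hxS⟩ := mem_closure_iff_nhds.1 hd (U ∩ V) (inter_mem hU hV)
    exact ⟨x, hx.1, hxS, hx.2⟩

/-- For a closed unbounded `C`, the "next element of `C`" map, constant near points off `C`. -/
theorem OmegaOne.exists_next {C : Set OmegaOne} (hC : IsClosed C) (hCu : ¬ BddAbove C) :
    ∃ N : OmegaOne → OmegaOne, (∀ z, z ≤ N z) ∧ ∀ z ∉ C, {w | N w = N z} ∈ 𝓝 z := by
  have h : ∀ z, ∃ c, (c ∈ C ∧ z ≤ c) ∧ ∀ c' ∈ C, z ≤ c' → c ≤ c' := fun z => by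
    obtain ⟨c, hc, hmin⟩ := wellFounded_lt.has_min {c | c ∈ C ∧ z ≤ c} (exists_mem_ge hCu z)
    exact ⟨c, hc, fun c' hc' hz => not_lt.1 (hmin c' ⟨hc', hz⟩)⟩
  choose N hN hmin using h
  have key : ∀ w z, w ≤ z → Icc w z ⊆ Cᶜ → N w = N z := fun w z hwz hsub => by
    refine le_antisymm (hmin _ _ (hN z).1 (hwz.trans (hN z).2)) (hmin _ _ (hN w).1 ?_)
    by_contra! hlt
    exact hsub ⟨(hN w).2, hlt.le⟩ (hN w).1
  refine ⟨N, fun z => (hN z).2, fun z hz => ?_⟩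
  filter_upwards [ordConnectedComponent_mem_nhds.2 (hC.isOpen_compl.mem_nhds hz)] with w hw
  rw [mem_ordConnectedComponent] at hw
  obtain hwz | hzw := le_total w z
  · exact key w z hwz (uIcc_of_ge hwz ▸ hw)
  · exact (key z w hzw (uIcc_of_le hzw ▸ hw)).symm

theorem HasCalibre.exists_club {S : Set OmegaOne} (hS : ¬ BddAbove S)
    (hP : HasCalibre (Compacts S) (Cardinal.aleph 1) (Cardinal.aleph 1) Cardinal.aleph0) :
    ∃ C ⊆ S, IsClosed C ∧ ¬ BddAbove C := by
  choose e heS hle using OmegaOne.exists_mem_ge hS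
  obtain ⟨A, hA, h⟩ := hP.exists_unbounded_ambient (fun a => {e a}) (fun _ => isCompact_singleton)
    (fun a => singleton_subset_iff.2 (heS a))
  -- A point of this closure is the limit of a sequence, whose terms lie in one closed subset of
  -- `S`.
  refine ⟨closure (e '' A), fun x hx => ?_, isClosed_closure, fun hb => hA ?_⟩
  · obtain ⟨u, hu, hux⟩ := mem_closure_iff_seq_limit.1 hx
    choose a ha hau using hu
    obtain ⟨K, hK, hKS, hFK⟩ := h (range a) (by rintro _ ⟨n, rfl⟩; exact ha n) (countable_range a)
    refine hKS (hK.mem_of_tendsto hux (Eventually.of_forall fun n => ?_))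
    exact hFK _ (mem_range_self n) (hau n).symm
  · obtain ⟨b, hb⟩ := hb
    exact ⟨b, fun a ha => (hle a).trans (hb (subset_closure ⟨a, ha, rfl⟩))⟩

theorem HasCalibre.bddAbove_closure_diff {S : Set OmegaOne} (hS : ¬ BddAbove S)
    (hP : HasCalibre (Compacts S) (Cardinal.aleph 1) (Cardinal.aleph 1) Cardinal.aleph0) :
    BddAbove (closure S \ S) := by
  by_contra hD
  obtain ⟨C, hCS, hC, hCu⟩ := hP.exists_club hS
  obtain ⟨N, hN, hNnhds⟩ := OmegaOne.exists_next hC hCu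
  set G := N '' (closure S \ S)
  have hGu : ¬ BddAbove G := fun ⟨b, hb⟩ =>
    hD ⟨b, fun d hd => (hN d).trans (hb ⟨d, hd, rfl⟩)⟩
  have hseq : ∀ g : OmegaOne, ∃ d, ∃ s : ℕ → OmegaOne, g ∈ G →
      d ∉ S ∧ Tendsto s atTop (𝓝 d) ∧ ∀ n, s n ∈ S ∧ N (s n) = g := by
    intro g
    by_cases hg : g ∈ G
    · obtain ⟨d, hd, rfl⟩ := hg
      obtain ⟨s, hs, hsd⟩ := mem_closure_iff_seq_limit.1
        (mem_closure_inter_of_mem_nhds hd.1 (hNnhds d fun h => hd.2 (hCS h)))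
      exact ⟨d, s, fun _ => ⟨hd.2, hsd, hs⟩⟩
    · exact ⟨g, fun _ => g, fun h => absurd h hg⟩
  choose d s hds using hseq
  have hinj : ∀ a : OmegaOne, ∃ f : OmegaOne → ℕ, InjOn f (Iio a) := fun a =>
    countable_iff_exists_injOn.1 (OmegaOne.countable_Iio a)
  choose f hf using hinj
  -- In each gap of `C` indexed by some `g < a` in `G`, `F a` picks one point, whose position on the
  -- sequence is the injective code `f a g`.
  set F : OmegaOne → Set OmegaOne := fun a =>
    C ∩ Iic a ∪ (fun g => s g (f a g)) '' (G ∩ Iio a)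
  have hFS : ∀ a, F a ⊆ S := by
    rintro a x (hx | ⟨g, hg, rfl⟩)
    · exact hCS hx.1
    · exact ((hds g hg.1).2.2 _).1
  have hFc : ∀ a, IsCompact (F a) := by
    intro a
    refine OmegaOne.isCompact_of_isClosed_of_bddAbove ?_ ⟨a, ?_⟩
    · refine isClosed_of_closure_subset fun x hx => ?_
      by_cases hxC : x ∈ C
      · refine Or.inl ⟨hxC, ?_⟩
        refine closure_minimal ?_ isClosed_Iic hx
        rintro y (hy | ⟨g, hg, rfl⟩)
        · exact hy.2
        · refine (hN _).trans ?_
          rw [((hds g hg.1).2.2 _).2]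
          exact hg.2.le
      -- Near a point off `C` only one gap is visible, hence at most one point of `F a`.
      · have hx' := mem_closure_inter_of_mem_nhds hx
          (inter_mem (hNnhds x hxC) (hC.isOpen_compl.mem_nhds hxC))
        have hsub : F a ∩ ({w | N w = N x} ∩ Cᶜ) ⊆ {s (N x) (f a (N x))} := by
          rintro y ⟨hy | ⟨g, hg, rfl⟩, hyN, hyC⟩
          · exact absurd hy.1 hyC
          · have : g = N x := by rw [← hyN]; exact ((hds g hg.1).2.2 _).2.symm
            rw [← this]
            rfl
        rw [((finite_singleton _).subset hsub).isClosed.closure_eq] at hx'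
        exact hx'.1
    · rintro y (hy | ⟨g, hg, rfl⟩)
      · exact hy.2
      · refine (hN _).trans ?_
        rw [((hds g hg.1).2.2 _).2]
        exact hg.2.le
  obtain ⟨A, hA, h⟩ := hP.exists_unbounded_ambient F hFc hFS
  have hM : ∀ g, ∃ M, g ∈ G → ∀ a ∈ A, g < a → f a g ≤ M := by
    intro g
    by_cases hg : g ∈ G
    · obtain ⟨M, hM⟩ := exists_bound_of_tendsto (φ := fun a => f a g) (A' := {a ∈ A | g < a}) h
        (hds g hg).1 (hds g hg).2.1 (fun a ha => ha.1) fun a ha => Or.inr ⟨g, ⟨hg, ha.2⟩, rfl⟩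
      exact ⟨M, fun _ a ha hga => hM a ⟨ha, hga⟩⟩
    · exact ⟨0, fun h => absurd h hg⟩
  choose M hM using hM
  obtain ⟨m, hm⟩ := OmegaOne.exists_unbounded_fiber hGu M
  have hinf : {g ∈ G | M g = m}.Infinite := fun hfin =>
    hm (OmegaOne.bddAbove_of_countable hfin.countable)
  -- Pigeonhole: `f a` would inject these `m + 2` indices into `{0, …, m}`.
  obtain ⟨t, ht, htcard⟩ := hinf.exists_subset_card_eq (m + 2)
  obtain ⟨b, hb⟩ := OmegaOne.bddAbove_of_countable t.countable_toSet
  obtain ⟨a, ha, hba⟩ := not_bddAbove_iff.1 hA b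
  have hta : ∀ g ∈ t, g < a := fun g hg => (hb hg).trans_lt hba
  have hcard : t.card ≤ (Finset.range (m + 1)).card := by
    refine Finset.card_le_card_of_injOn (f a) (fun g hg => ?_) fun x hx y hy hxy =>
      hf a (hta x hx) (hta y hy) hxy
    have := hM g (ht hg).1 a ha (hta g hg)
    rw [(ht hg).2] at this
    simpa using Nat.lt_succ_of_le this
  simp [htcard] at hcard

theorem exists_eventually_bound_of_countable {ι : Type*} {B : Set ι} (hB : B.Countable)
    (h : ι → ℕ → ℕ) : ∃ g : ℕ → ℕ, ∀ b ∈ B, ∀ᶠ n in atTop, h b n ≤ g n := by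
  obtain rfl | hne := B.eq_empty_or_nonempty
  · exact ⟨0, by simp⟩
  obtain ⟨e, rfl⟩ := hB.exists_eq_range hne
  refine ⟨fun n => (Finset.range (n + 1)).sup fun i => h (e i) n, ?_⟩
  rintro _ ⟨i, rfl⟩
  filter_upwards [eventually_ge_atTop i] with n hn
  exact Finset.le_sup (f := fun i => h (e i) n) (Finset.mem_range.2 (Nat.lt_succ_of_le hn))

/-- If `𝔟 ≤ ℵ₁`, some `ω₁`-sequence in `ℕ → ℕ` has no uncountable pointwise bounded
subfamily. -/
theorem exists_family_of_boundingNumber_le (hb : boundingNumber ≤ Cardinal.aleph 1) :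
    ∃ f : OmegaOne → ℕ → ℕ, ∀ A : Set OmegaOne, ¬ BddAbove A →
      ¬ ∃ g : ℕ → ℕ, ∀ a ∈ A, ∀ n, f a n ≤ g n := by
  have hne : {c : Cardinal.{0} | ∃ F : Set (ℕ → ℕ), Cardinal.mk F = c ∧
      ¬ ∃ g : ℕ → ℕ, ∀ f ∈ F, ∀ᶠ n in atTop, f n ≤ g n}.Nonempty := by
    refine ⟨_, univ, rfl, fun ⟨g, hg⟩ => ?_⟩
    obtain ⟨n, hn⟩ := (hg (fun n => g n + 1) (mem_univ _)).exists
    exact absurd hn (by simp)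
  obtain ⟨H, hHcard, hH⟩ := csInf_mem hne
  have hle : Cardinal.lift.{1} (Cardinal.mk H) ≤ Cardinal.lift.{0} (Cardinal.mk OmegaOne) := by
    have := Cardinal.lift_le.{1}.2 (hHcard.le.trans hb)
    simpa [OmegaOne.mk_eq] using this
  have hHne : Nonempty H := by
    by_contra hemp
    exact hH ⟨0, fun f hf => absurd ⟨⟨f, hf⟩⟩ hemp⟩
  obtain ⟨i⟩ := Cardinal.lift_mk_le'.1 hle
  have hsurj := Function.invFun_surjective i.injective
  set h := Function.invFun i
  -- Each `f a` eventually dominates all earlier `h b`, so a bound for unboundedly many `f a` would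
  -- dominate all of `H`.
  choose f hf using fun a : OmegaOne =>
    exists_eventually_bound_of_countable (OmegaOne.countable_Iic a) fun b => (h b).1
  refine ⟨f, fun A hA ⟨g, hg⟩ => hH ⟨g, fun u hu => ?_⟩⟩
  obtain ⟨b, hbu⟩ := hsurj ⟨u, hu⟩
  obtain ⟨a, ha, hba⟩ := OmegaOne.exists_mem_ge hA b
  filter_upwards [hf a b hba] with n hn
  rw [hbu] at hn
  exact hn.trans (hg a ha n)

theorem HasCalibre.aleph_one_lt_boundingNumber {S : Set OmegaOne}
    (hP : HasCalibre (Compacts S) (Cardinal.aleph 1) (Cardinal.aleph 1) Cardinal.aleph0)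
    (hD : ¬ IsClosed (closure S \ S)) : Cardinal.aleph 1 < boundingNumber := by
  by_contra! hb
  obtain ⟨f, hf⟩ := exists_family_of_boundingNumber_le hb
  obtain ⟨x, hx, hxD⟩ : ∃ x ∈ closure (closure S \ S), x ∉ closure S \ S := by
    by_contra! h
    exact hD (isClosed_of_closure_subset h)
  have hxS : x ∈ S := by
    by_contra h
    exact hxD ⟨closure_minimal sdiff_subset isClosed_closure hx, h⟩
  obtain ⟨V, hV⟩ := (𝓝 x).exists_antitone_basis
  have hseq : ∀ n, ∃ d, ∃ s : ℕ → OmegaOne, d ∉ S ∧ Tendsto s atTop (𝓝 d) ∧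
      ∀ k, s k ∈ S ∩ V n := by
    intro n
    obtain ⟨d, hdV, hdD⟩ := mem_closure_iff_nhds.1 hx _ (interior_mem_nhds.2 (hV.1.mem_of_mem trivial : V n ∈ 𝓝 x))
    obtain ⟨s, hs, hsd⟩ := mem_closure_iff_seq_limit.1
      (mem_closure_inter_of_mem_nhds hdD.1 (mem_interior_iff_mem_nhds.1 hdV))
    exact ⟨d, s, hdD.2, hsd, hs⟩
  choose d s hdS hsd hs using hseq
  -- The `n`-th picked point lies in `V n`, so the points converge to `x`: any function is coded by
  -- a compact set.
  obtain ⟨A, hA, h⟩ := hP.exists_unbounded_ambient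
    (fun a => insert x (range fun n => s n (f a n)))
    (fun a => (hV.tendsto fun n => (hs n _).2).isCompact_insert_range)
    (fun a => insert_subset hxS (by rintro _ ⟨n, rfl⟩; exact (hs n _).1))
  choose g hg using fun n => exists_bound_of_tendsto (φ := fun a => f a n) h (hdS n) (hsd n)
    subset_rfl fun a _ => Or.inr ⟨n, rfl⟩
  exact hf A hA ⟨g, fun a ha n => hg n a ha⟩

/-! ### Sufficiency -/

/-- Calibre `(ℵ₁, ℵ₁, ℵ₀)` holds if each family of `ℵ₁` compacts can be covered by countably many
closed sets contained in `S`. -/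
theorem hasCalibre_of_closed_cover {S : Set OmegaOne}
    (h : ∀ T : Set (Compacts S), Cardinal.mk T = Cardinal.aleph 1 →
      ∃ (κ : Type 1) (_ : Countable κ) (L : κ → Set OmegaOne),
        (∀ k, IsClosed (L k) ∧ L k ⊆ S) ∧ ∀ K ∈ T, ∃ k, K.ambient ⊆ L k) :
    HasCalibre (Compacts S) (Cardinal.aleph 1) (Cardinal.aleph 1) Cardinal.aleph0 := by
  intro T hT
  obtain ⟨κ, _, L, hL, hTL⟩ := h T hT
  obtain ⟨k, hk⟩ : ∃ k, ¬ {K ∈ T | K.ambient ⊆ L k}.Countable := by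
    by_contra! hc
    have hTc : T.Countable := (countable_iUnion hc).mono fun K hK => by
      obtain ⟨k, hk⟩ := hTL K hK
      exact mem_iUnion.2 ⟨k, hK, hk⟩
    rw [← Cardinal.le_aleph0_iff_set_countable, hT] at hTc
    exact absurd hTc (not_le.2 Cardinal.aleph0_lt_aleph_one)
  have hsub : {K ∈ T | K.ambient ⊆ L k} ⊆ T := fun K hK => hK.1
  refine ⟨_, hsub, le_antisymm ((Cardinal.mk_le_mk_of_subset hsub).trans hT.le) ?_, ?_⟩
  · rw [← Cardinal.succ_aleph0, Order.succ_le_iff, ← not_le, Cardinal.le_aleph0_iff_set_countable]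
    exact hk
  · intro T₁ hT₁ hcard
    have hc : T₁.Countable := Cardinal.le_aleph0_iff_set_countable.1 hcard.le
    have hbd : ∀ K : Compacts S, BddAbove K.ambient := fun K =>
      have : Nonempty OmegaOne := ⟨⟨0, Ordinal.omega_pos 1⟩⟩
      K.isCompact_ambient.bddAbove
    have hU : (⋃ K ∈ T₁, K.ambient).Countable :=
      hc.biUnion fun K _ => OmegaOne.countable_of_bddAbove (hbd K)
    obtain ⟨b, hb⟩ := OmegaOne.bddAbove_of_countable hU
    -- `L k` may be unbounded, but countably many compacts lie below one `b`.
    refine ⟨Compacts.ofAmbient (L k ∩ Iic b)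
      (OmegaOne.isCompact_of_isClosed_of_bddAbove ((hL k).1.inter isClosed_Iic)
        ⟨b, fun x hx => hx.2⟩) (inter_subset_left.trans (hL k).2), fun K hK => ?_⟩
    refine Compacts.le_ofAmbient fun x hx => ⟨(hT₁ hK).2 hx, hb ?_⟩
    exact mem_iUnion₂.2 ⟨K, hK, hx⟩

theorem exists_antitone_basis_isOpen {X : Type*} [TopologicalSpace X] [FirstCountableTopology X]
    (x : X) : ∃ U : ℕ → Set X, (∀ n, x ∈ U n ∧ IsOpen (U n)) ∧ (𝓝 x).HasAntitoneBasis U := by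
  obtain ⟨U, hU, hb⟩ := (nhds_basis_opens x).exists_antitone_subbasis
  exact ⟨U, hU, hb⟩

theorem exists_disjoint_of_hasAntitoneBasis {X : Type*} [TopologicalSpace X]
    {x : X} {U : ℕ → Set X} (hU : (𝓝 x).HasAntitoneBasis U) {K : Set X}
    (hK : IsClosed K) (hx : x ∉ K) : ∃ n, Disjoint K (U n) := by
  obtain ⟨n, -, hn⟩ := hU.1.mem_iff.1 (hK.isOpen_compl.mem_nhds hx)
  exact ⟨n, disjoint_left.2 fun y hy hyU => hn hyU hy⟩

theorem hasCalibre_of_isClosed {S : Set OmegaOne} (hb : BddAbove (closure S \ S))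
    (hc : IsClosed (closure S \ S)) :
    HasCalibre (Compacts S) (Cardinal.aleph 1) (Cardinal.aleph 1) Cardinal.aleph0 := by
  choose U hU hUb using fun x : OmegaOne => exists_antitone_basis_isOpen x
  set D := closure S \ S
  have hDc : Countable D := (OmegaOne.countable_of_bddAbove hb).to_subtype
  have hDK : IsCompact D := OmegaOne.isCompact_of_isClosed_of_bddAbove hc hb
  refine hasCalibre_of_closed_cover fun T _ =>
    ⟨{t : Finset (D × ℕ) // D ⊆ ⋃ p ∈ t, U p.1 p.2}, inferInstance,
      fun t => closure S \ ⋃ p ∈ t.1, U p.1 p.2, fun t => ⟨?_, ?_⟩, fun K _ => ?_⟩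
  · exact isClosed_closure.sdiff (isOpen_biUnion fun p _ => (hU p.1 p.2).2)
  · intro x hx
    by_contra hxS
    exact hx.2 (t.2 ⟨hx.1, hxS⟩)
  · choose n hn using fun x : D => exists_disjoint_of_hasAntitoneBasis (hUb x)
      K.isCompact_ambient.isClosed fun h => x.2.2 (K.ambient_subset h)
    obtain ⟨t, ht⟩ := hDK.elim_finite_subcover (fun x : D => U x (n x)) (fun x => (hU x _).2)
      fun x hx => mem_iUnion.2 ⟨⟨x, hx⟩, (hU x _).1⟩
    classical
    refine ⟨⟨t.image fun x => (x, n x), fun x hx => ?_⟩, fun y hy => ⟨?_, ?_⟩⟩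
    · obtain ⟨z, hz, hxz⟩ := mem_iUnion₂.1 (ht hx)
      exact mem_iUnion₂.2 ⟨(z, n z), Finset.mem_image_of_mem _ hz, hxz⟩
    · exact subset_closure (K.ambient_subset hy)
    · simp only [Finset.mem_image, mem_iUnion, not_exists]
      rintro _ ⟨x, -, rfl⟩ hyU
      exact disjoint_left.1 (hn x) hy hyU

theorem exists_eventually_bound_of_lt_boundingNumber {ι : Type 1} (f : ι → ℕ → ℕ)
    (hι : Cardinal.mk ι = Cardinal.aleph 1) (hb : Cardinal.aleph 1 < boundingNumber) :
    ∃ g : ℕ → ℕ, ∀ i, ∀ᶠ n in atTop, f i n ≤ g n := by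
  by_contra h
  refine absurd hb (not_lt.2 ?_)
  have hle : boundingNumber ≤ Cardinal.mk (range f) :=
    csInf_le' ⟨range f, rfl, fun ⟨g, hg⟩ => h ⟨g, fun i => hg _ (mem_range_self i)⟩⟩
  refine hle.trans ?_
  have := Cardinal.mk_range_le_lift (f := f)
  rw [hι] at this
  rw [← Cardinal.lift_le.{1}]
  simpa using this

theorem exists_add_bound {f g : ℕ → ℕ} (h : ∀ᶠ n in atTop, f n ≤ g n) :
    ∃ N, ∀ n, f n ≤ g n + N := by
  obtain ⟨m, hm⟩ := eventually_atTop.1 h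
  refine ⟨(Finset.range m).sup f, fun n => ?_⟩
  obtain hn | hn := lt_or_ge n m
  · exact (Finset.le_sup (Finset.mem_range.2 hn)).trans (Nat.le_add_left _ _)
  · exact (hm n hn).trans (Nat.le_add_right _ _)

theorem hasCalibre_of_lt_boundingNumber {S : Set OmegaOne} (hb : BddAbove (closure S \ S))
    (hlt : Cardinal.aleph 1 < boundingNumber) :
    HasCalibre (Compacts S) (Cardinal.aleph 1) (Cardinal.aleph 1) Cardinal.aleph0 := by
  obtain hD | hne := (closure S \ S).eq_empty_or_nonempty
  · exact hasCalibre_of_isClosed hb (by rw [hD]; exact isClosed_empty)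
  obtain ⟨d, hd⟩ := (OmegaOne.countable_of_bddAbove hb).exists_eq_range hne
  have hdS : ∀ n, d n ∉ S := fun n => (hd ▸ mem_range_self n : d n ∈ closure S \ S).2
  choose U hU hUb using fun n => exists_antitone_basis_isOpen (d n)
  refine hasCalibre_of_closed_cover fun T hT => ?_
  choose f hf using fun (K : T) (n : ℕ) => exists_disjoint_of_hasAntitoneBasis (hUb n)
    K.1.isCompact_ambient.isClosed fun h => hdS n (K.1.ambient_subset h)
  obtain ⟨g, hg⟩ := exists_eventually_bound_of_lt_boundingNumber f hT hlt
  -- Adding a constant `N` turns eventual domination by `g` into domination everywhere, at the cost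
  -- of countably many closed sets.
  refine ⟨ULift ℕ, inferInstance, fun N => closure S \ ⋃ n, U n (g n + N.down),
    fun N => ⟨?_, ?_⟩, fun K hK => ?_⟩
  · exact isClosed_closure.sdiff (isOpen_iUnion fun n => (hU n _).2)
  · intro x hx
    by_contra hxS
    obtain ⟨n, rfl⟩ : x ∈ range d := hd ▸ ⟨hx.1, hxS⟩
    exact hx.2 (mem_iUnion.2 ⟨n, (hU n _).1⟩)
  · obtain ⟨N, hN⟩ := exists_add_bound (hg ⟨K, hK⟩)
    refine ⟨⟨N⟩, fun y hy => ⟨subset_closure (K.ambient_subset hy), fun hyU => ?_⟩⟩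
    obtain ⟨n, hn⟩ := mem_iUnion.1 hyU
    exact disjoint_left.1 (hf ⟨K, hK⟩ n) hy ((hUb n).antitone (hN n) hn)

theorem mainTheorem6 (S : Set OmegaOne) (hS : ¬ BddAbove S) :
    HasCalibre (TopologicalSpace.Compacts S)
        (Cardinal.aleph 1) (Cardinal.aleph 1) Cardinal.aleph0 ↔
      BddAbove (closure S \ S) ∧
        (IsClosed (closure S \ S) ∨ Cardinal.aleph 1 < boundingNumber) := by
  refine ⟨fun hP => ⟨hP.bddAbove_closure_diff hS, ?_⟩, ?_⟩
  · exact or_iff_not_imp_left.2 hP.aleph_one_lt_boundingNumber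
  · rintro ⟨hb, hc | hlt⟩
    · exact hasCalibre_of_isClosed hb hc
    · exact hasCalibre_of_lt_boundingNumber hb hlt
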